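/- Let $(\Omega,\mathcal F,\mathsf P)$ be a probability space, $L^0$ the space of real random variables modulo $\mathsf P$-a.s. equality, and $\mathcal P$ the set of probability measures on $\mathcal F$ absolutely continuous with respect to $\mathsf P$. For $\mathsf Q\in\mathcal P$ and $X\in L^0$ put $\mathsf E_{\mathsf Q}X=\mathsf E_{\mathsf Q}X^+-\mathsf E_{\mathsf Q}X^-\in[-\infty,\infty]$ with the convention $\infty-\infty=-\infty$. Let $u$ be a coherent utility function on $L^0$, i.e. $u(X)=\inf_{\mathsf Q\in\mathcal D'}\mathsf E_{\mathsf Q}X$ for all $X\in L^0$, for some nonempty $\mathcal D'\subseteq\mathcal P$, and let $\mathcal D$ be its determining set, i.e. the largest set $\mathcal D'\subseteq\mathcal P$ representing $u$ in this way. Assume that $\mathcal D$ is weakly compact, i.e. compact for $\sigma(L^1,L^\infty)$ when measures are identified with their densities with respect to $\mathsf P$. Let $$L^1_s(\mathcal D)=\Bigl\{X\in L^0:\lim_{n\to\infty}\sup_{\mathsf Q\in\mathcal D}\mathsf E_{\mathsf Q}|X|I(|X|>n)=0\Bigr\}.$$ For $B\subseteq L^0$ let $\mathcal R(B)=\{\mathsf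 Q\in\mathcal P:\mathsf E_{\mathsf Q}X\le 0\text{ for all }X\in B\}$. Let $A\subseteq L^0$ be a convex set containing $0$ that is $\mathcal D$-consistent, i.e. there is $A'\subseteq L^1_s(\mathcal D)\cap A$ with $\mathcal D\cap\mathcal R(A)=\mathcal D\cap\mathcal R(A')$, and write $\mathcal R=\mathcal R(A)$. Let $W,F\in L^1_s(\mathcal D)$. A real number $x$ is a single-agent No-Better-Choice (NBC) price of $F$ if $$\max_{X\in A,\,h\in\mathbb R}u\bigl(W+X+h(F-x)\bigr)=u(W),$$ and $I_{\mathrm{NBC}}(F)$ denotes the set of these prices. Let $\mathcal X_{\mathcal D}(W)=\{\mathsf Q\in\mathcal D:\mathsf E_{\mathsf Q}W=u(W)\in(-\infty,\infty)\}$ be the set of extreme measures of $W$. 1. One has $$I_{\mathrm{NBC}}(F)=\{\mathsf E_{\mathsf Q}F:\mathsf Q\in\mathcal X_{\mathcal D}(W)\cap\mathcal R\}.$$ 2. Assume in addition that $W$ is optimal, i.e. $\max_{X\in A}u(W+X)=u(W)$. Let $G=\{(\mathsf E_{\mathsf Q}F,\mathsf E_{\mathsf Q}W):\mathsf Q\in\mathcal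 D\cap\mathcal R\}\subseteq\mathbb R^2$ and $f(x)=\inf\{y\in\mathbb R:(x,y)\in G\}$ for $x\in\mathbb R$, with $\inf\emptyset=+\infty$. Then $$I_{\mathrm{NBC}}(F)=\operatorname*{argmin}_{x\in\mathbb R}f(x),$$ where $\operatorname{argmin}_{x\in\mathbb R} f(x)=\{x\in\mathbb R: f(x)\le f(y)\text{ for all }y\in\mathbb R\}$. -/

import Mathlib

open MeasureTheory Filter Topology
open scoped ENNReal

namespace CoherentRisk

variable {Ω : Type*} [MeasurableSpace Ω]

/-- The set of probability measures on the sigma-algebra that are absolutely continuous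
with respect to `P`. -/
def absContProb (P : Measure Ω) : Set (Measure Ω) :=
  {Q | IsProbabilityMeasure Q ∧ Q ≪ P}

/-- The expectation `E_Q X = E_Q X⁺ - E_Q X⁻` in `[-∞, ∞]` of a random variable `X ∈ L⁰(P)`,
with the convention `∞ - ∞ = -∞` (which is the value of `⊤ - ⊤` in `EReal`).
It does not depend on the representative of `X` when `Q ≪ P`. -/
noncomputable def expect {P : Measure Ω} (Q : Measure Ω) (X : Ω →ₘ[P] ℝ) : EReal :=
  ((∫⁻ ω, ENNReal.ofReal (X ω) ∂Q : ℝ≥0∞) : EReal) -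
    ((∫⁻ ω, ENNReal.ofReal (-X ω) ∂Q : ℝ≥0∞) : EReal)

/-- `u : L⁰ → [-∞, ∞]` is the coherent utility function `u(X) = inf_{Q ∈ D} E_Q X` given by
the nonempty set `D` of probability measures absolutely continuous with respect to `P`. -/
def Represents (P : Measure Ω) (u : (Ω →ₘ[P] ℝ) → EReal) (D : Set (Measure Ω)) : Prop :=
  D.Nonempty ∧ D ⊆ absContProb P ∧ ∀ X : Ω →ₘ[P] ℝ, u X = ⨅ Q ∈ D, expect Q X

/-- `u` is a coherent utility function on `L⁰` and `D` is its determining set, that is, the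
largest set which represents `u`. -/
def IsDeterminingSet (P : Measure Ω) (u : (Ω →ₘ[P] ℝ) → EReal) (D : Set (Measure Ω)) : Prop :=
  IsGreatest {D' : Set (Measure Ω) | Represents P u D'} D

/-- The coarsest topology for which `Q ↦ ∫ Z dQ` is continuous for every bounded measurable `Z`.
On probability measures absolutely continuous with respect to `P`, identified with their
densities in `L¹(P)`, this is the weak topology `σ(L¹, L^∞)`. -/
@[reducible] noncomputable def weakTopology (Ω : Type*) [MeasurableSpace Ω] : TopologicalSpace (Measure Ω) :=
  TopologicalSpace.induced
    (fun (Q : Measure Ω) (Z : {Z : Ω → ℝ // Measurable Z ∧ ∃ C : ℝ, ∀ ω, |Z ω| ≤ C}) =>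
      ∫ ω, Z.1 ω ∂Q)
    Pi.topologicalSpace

/-- Weak compactness of a set of measures. -/
def IsWeaklyCompact (D : Set (Measure Ω)) : Prop :=
  @IsCompact (Measure Ω) (weakTopology Ω) D

/-- The strong `L¹`-space of `D`: all `X ∈ L⁰` with
`sup_{Q ∈ D} E_Q (|X| 1_{|X| > n}) → 0` as `n → ∞`. -/
def strongL1 (P : Measure Ω) (D : Set (Measure Ω)) : Set (Ω →ₘ[P] ℝ) :=
  {X | Tendsto (fun n : ℕ => ⨆ Q ∈ D, ∫⁻ ω in {ω | (n : ℝ) < |X ω|}, ENNReal.ofReal |X ω| ∂Q)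
    atTop (𝓝 0)}

/-- The set of risk-neutral measures of the set `A` of attainable P&Ls. -/
def riskNeutral {P : Measure Ω} (A : Set (Ω →ₘ[P] ℝ)) : Set (Measure Ω) :=
  {Q | Q ∈ absContProb P ∧ ∀ X ∈ A, expect Q X ≤ 0}

/-- `A` is `D`-consistent: on `D`, risk-neutrality can be tested on elements of `A` that belong
to the strong `L¹`-space of `D`. -/
def IsConsistent {P : Measure Ω} (D : Set (Measure Ω)) (A : Set (Ω →ₘ[P] ℝ)) : Prop :=
  ∃ A' : Set (Ω →ₘ[P] ℝ), A' ⊆ strongL1 P D ∩ A ∧ D ∩ riskNeutral A = D ∩ riskNeutral A'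

/-- The set of extreme measures of `X`: all `Q ∈ D` with `E_Q X = u(X) ∈ (-∞, ∞)`, where
`u(X) = inf_{Q ∈ D} E_Q X`. -/
def extremeMeasures {P : Measure Ω} (D : Set (Measure Ω)) (X : Ω →ₘ[P] ℝ) : Set (Measure Ω) :=
  {Q | Q ∈ D ∧ expect Q X = (⨅ Q' ∈ D, expect Q' X) ∧ expect Q X ≠ ⊥ ∧ expect Q X ≠ ⊤}

/-- The set of single-agent No-Better-Choice prices of `F`: all real `x` with
`max_{X ∈ A, h ∈ ℝ} u(W + X + h (F - x)) = u(W)` (the maximum being attained). -/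
def nbcPrices {P : Measure Ω} (u : (Ω →ₘ[P] ℝ) → EReal) (A : Set (Ω →ₘ[P] ℝ))
    (W F : Ω →ₘ[P] ℝ) : Set ℝ :=
  {x | IsGreatest {r : EReal | ∃ X ∈ A, ∃ h : ℝ,
    r = u (W + X + h • (F - AEEqFun.const Ω x))} (u W)}

/-- The endowment `W` is optimal: `max_{X ∈ A} u(W + X) = u(W)`. -/
def IsOptimalEndowment {P : Measure Ω} (u : (Ω →ₘ[P] ℝ) → EReal) (A : Set (Ω →ₘ[P] ℝ))
    (W : Ω →ₘ[P] ℝ) : Prop :=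
  IsGreatest {r : EReal | ∃ X ∈ A, r = u (W + X)} (u W)

/-- The two-dimensional generator `{E_Q (F, W) : Q ∈ D ∩ R}`, where `R` is the set of
risk-neutral measures of `A`. -/
def generator {P : Measure Ω} (D : Set (Measure Ω)) (A : Set (Ω →ₘ[P] ℝ))
    (F W : Ω →ₘ[P] ℝ) : Set (ℝ × ℝ) :=
  {p | ∃ Q ∈ D ∩ riskNeutral A, expect Q F = (p.1 : EReal) ∧ expect Q W = (p.2 : EReal)}

/-- The lower boundary `f(x) = inf {y : (x, y) ∈ G}` of a planar set, with `inf ∅ = ∞`. -/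
noncomputable def lowerBoundary (G : Set (ℝ × ℝ)) (x : ℝ) : EReal :=
  ⨅ y : {y : ℝ // (x, y) ∈ G}, ((y : ℝ) : EReal)

/-- The set of points at which `f : ℝ → [-∞, ∞]` attains its minimum over `ℝ`. -/
def argmin (f : ℝ → EReal) : Set ℝ :=
  {x | ∀ y : ℝ, f x ≤ f y}

end CoherentRisk

namespace CoherentRisk

variable {Ω : Type*} [MeasurableSpace Ω] {P : Measure Ω}

/-! If a risk-neutral extreme measure `Q` of `W` prices `F` at `x`, then every trade has utility at
most its `Q`-expectation, which is at most `E_Q W = u(W)` (`expect_hedged_le`); so `x` is an NBC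
price.

Conversely, suppose no trade improves on `W`. One looks in `D` for `Q` with `E_Q W ≤ u(W)`, `E_Q F =
x` and `E_Q X ≤ 0` for `X ∈ A'`. These conditions are weakly closed (`continuousOn_integral`), so by
compactness finitely many `X` may be treated at a time. If they had no solution, the compact convex
set of vectors `(E_Q W, E_Q F, E_Q X_i)` could be strictly separated from the admissible orthant,
and the separating weights, suitably scaled, would be an improving trade
(`exists_measure_of_finite`).

For the second part, optimality of `W` makes `u(W)` the minimum of `f`. -/

lemma expect_eq_integral {Q : Measure Ω} {X : Ω →ₘ[P] ℝ} (hX : Integrable X Q) :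
    expect Q X = ((∫ ω, X ω ∂Q : ℝ) : EReal) := by
  have h1 : ∫⁻ ω, ENNReal.ofReal (X ω) ∂Q ≠ ⊤ := hX.lintegral_lt_top.ne
  have h2 : ∫⁻ ω, ENNReal.ofReal (-X ω) ∂Q ≠ ⊤ := hX.neg.lintegral_lt_top.ne
  rw [expect, integral_eq_lintegral_pos_part_sub_lintegral_neg_part hX, EReal.coe_sub,
    EReal.coe_ennreal_toReal h1, EReal.coe_ennreal_toReal h2]

lemma expect_eq_bot {Q : Measure Ω} {X : Ω →ₘ[P] ℝ}
    (h : ∫⁻ ω, ENNReal.ofReal (-X ω) ∂Q = ⊤) : expect Q X = ⊥ := by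
  rw [expect, h, EReal.coe_ennreal_top, EReal.sub_top]

lemma expect_eq_top {Q : Measure Ω} {X : Ω →ₘ[P] ℝ}
    (h : ∫⁻ ω, ENNReal.ofReal (X ω) ∂Q = ⊤)
    (h' : ∫⁻ ω, ENNReal.ofReal (-X ω) ∂Q ≠ ⊤) : expect Q X = ⊤ := by
  rw [expect, h, EReal.coe_ennreal_top, ← EReal.coe_ennreal_toReal h', EReal.top_sub_coe]

lemma integrable_of_lintegral_ne_top {Q : Measure Ω} (X : Ω →ₘ[P] ℝ)
    (h : ∫⁻ ω, ENNReal.ofReal (X ω) ∂Q ≠ ⊤)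
    (h' : ∫⁻ ω, ENNReal.ofReal (-X ω) ∂Q ≠ ⊤) : Integrable X Q := by
  refine ⟨X.stronglyMeasurable.aestronglyMeasurable, ?_⟩
  rw [hasFiniteIntegral_iff_norm]
  refine lt_of_le_of_lt (b := ∫⁻ ω, (ENNReal.ofReal (X ω) + ENNReal.ofReal (-X ω)) ∂Q) ?_ ?_
  · refine lintegral_mono fun ω => ?_
    rcases le_total 0 (X ω) with h0 | h0
    · rw [Real.norm_of_nonneg h0]; exact le_self_add
    · rw [Real.norm_of_nonpos h0]; exact le_add_self
  · rw [lintegral_add_left X.measurable.ennreal_ofReal]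
    exact ENNReal.add_lt_top.2 ⟨h.lt_top, h'.lt_top⟩

/-- Under the convention `∞ - ∞ = -∞`, a nonintegrable `X` passes the test only through an infinite
negative part. -/
lemma integral_nonpos_or_lintegral_neg_eq_top {Q : Measure Ω} {X : Ω →ₘ[P] ℝ}
    (h : expect Q X ≤ 0) :
    (Integrable X Q ∧ ∫ ω, X ω ∂Q ≤ 0) ∨ ∫⁻ ω, ENNReal.ofReal (-X ω) ∂Q = ⊤ := by
  by_cases h' : ∫⁻ ω, ENNReal.ofReal (-X ω) ∂Q = ⊤
  · exact Or.inr h'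
  · by_cases h'' : ∫⁻ ω, ENNReal.ofReal (X ω) ∂Q = ⊤
    · rw [expect_eq_top h'' h'] at h
      simp at h
    · have hi := integrable_of_lintegral_ne_top X h'' h'
      rw [expect_eq_integral hi] at h
      exact Or.inl ⟨hi, by exact_mod_cast h⟩

/-- Adding a random variable of nonpositive expectation to an integrable one does not increase
the expectation, whether or not the former is integrable. -/
lemma expect_add_le {Q : Measure Ω} {X Z : Ω →ₘ[P] ℝ} {Y : Ω → ℝ} (hX : expect Q X ≤ 0)
    (hY : Integrable Y Q) (hZ : Z =ᵐ[Q] fun ω => X ω + Y ω) :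
    expect Q Z ≤ ((∫ ω, Y ω ∂Q : ℝ) : EReal) := by
  rcases integral_nonpos_or_lintegral_neg_eq_top hX with ⟨hi, h0⟩ | htop
  · rw [expect_eq_integral ((hi.add hY).congr hZ.symm), integral_congr_ae hZ,
      integral_add hi hY]
    exact_mod_cast by linarith
  · refine (expect_eq_bot ?_).trans_le bot_le
    -- Since `-X = -Z + Y`, a finite negative part of `Z` would make that of `X` finite.
    by_contra hne
    have hlt : ∫⁻ ω, ENNReal.ofReal (-Z ω) + ENNReal.ofReal (Y ω) ∂Q < ⊤ := by
      rw [lintegral_add_left (f := fun ω => ENNReal.ofReal (-Z ω))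
        Z.measurable.neg.ennreal_ofReal]
      exact ENNReal.add_lt_top.2 ⟨Ne.lt_top hne, hY.lintegral_lt_top⟩
    refine (lt_of_le_of_lt ?_ hlt).ne htop
    refine lintegral_mono_ae (hZ.mono fun ω hω => ?_)
    rw [hω]
    refine le_trans (ENNReal.ofReal_le_ofReal ?_) ENNReal.ofReal_add_le
    linarith

/-! ### Convexity of the determining set -/

lemma integral_convex_comb {Q₁ Q₂ : Measure Ω} {f : Ω → ℝ} (h₁ : Integrable f Q₁)
    (h₂ : Integrable f Q₂) {a b : ℝ} (ha : 0 ≤ a) (hb : 0 ≤ b) :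
    ∫ ω, f ω ∂(ENNReal.ofReal a • Q₁ + ENNReal.ofReal b • Q₂) =
      a * ∫ ω, f ω ∂Q₁ + b * ∫ ω, f ω ∂Q₂ := by
  rw [integral_add_measure (h₁.smul_measure (by simp)) (h₂.smul_measure (by simp))]
  simp [integral_smul_measure, ha, hb]

/-- A determining set is convex. -/
lemma IsDeterminingSet.convex {u : (Ω →ₘ[P] ℝ) → EReal} {D : Set (Measure Ω)}
    (hD : IsDeterminingSet P u D) {Q₁ Q₂ : Measure Ω} (h₁ : Q₁ ∈ D) (h₂ : Q₂ ∈ D) {a b : ℝ}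
    (ha : 0 ≤ a) (hb : 0 ≤ b) (hab : a + b = 1) :
    ENNReal.ofReal a • Q₁ + ENNReal.ofReal b • Q₂ ∈ D := by
  rcases ha.eq_or_lt with rfl | ha
  · obtain rfl : b = 1 := by linarith
    simpa using h₂
  rcases hb.eq_or_lt with rfl | hb
  · obtain rfl : a = 1 := by linarith
    simpa using h₁
  obtain ⟨⟨hne, hac, hu⟩, hmax⟩ := hD
  set Q := ENNReal.ofReal a • Q₁ + ENNReal.ofReal b • Q₂ with hQ
  have ha' : ENNReal.ofReal a ≠ 0 := by simpa using ha
  have hb' : ENNReal.ofReal b ≠ 0 := by simpa using hb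
  -- By maximality it suffices that adjoining `Q` leaves every infimum unchanged: `E_Q X` averages
  -- two expectations, so it is not below the smaller one.
  refine hmax (a := insert Q D) ⟨Set.insert_nonempty _ _, Set.insert_subset ⟨⟨?_⟩, ?_⟩ hac,
    fun X => ?_⟩ (Set.mem_insert _ _)
  · have := (hac h₁).1
    have := (hac h₂).1
    simp [hQ, ← ENNReal.ofReal_add ha.le hb.le, hab]
  · intro s hs
    simp [hQ, (hac h₁).2 hs, (hac h₂).2 hs]
  · rw [iInf_insert, hu X, eq_comm, inf_eq_right]
    have hle₁ : ⨅ Q ∈ D, expect Q X ≤ expect Q₁ X := iInf₂_le _ h₁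
    have hle₂ : ⨅ Q ∈ D, expect Q X ≤ expect Q₂ X := iInf₂_le _ h₂
    by_cases hn₁ : ∫⁻ ω, ENNReal.ofReal (-X ω) ∂Q₁ = ⊤
    · rw [expect_eq_bot hn₁] at hle₁; exact hle₁.trans bot_le
    by_cases hn₂ : ∫⁻ ω, ENNReal.ofReal (-X ω) ∂Q₂ = ⊤
    · rw [expect_eq_bot hn₂] at hle₂; exact hle₂.trans bot_le
    have hn : ∫⁻ ω, ENNReal.ofReal (-X ω) ∂Q ≠ ⊤ := by
      rw [hQ, lintegral_add_measure, lintegral_smul_measure, lintegral_smul_measure]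
      exact ENNReal.add_ne_top.2 ⟨ENNReal.mul_ne_top (by simp) hn₁,
        ENNReal.mul_ne_top (by simp) hn₂⟩
    by_cases hp : ∫⁻ ω, ENNReal.ofReal (X ω) ∂Q = ⊤
    · rw [expect_eq_top hp hn]; exact le_top
    have hi := integrable_of_lintegral_ne_top X hp hn
    have hi₁ : Integrable X Q₁ :=
      (integrable_smul_measure ha' (by simp)).1 (integrable_add_measure.1 hi).1
    have hi₂ : Integrable X Q₂ :=
      (integrable_smul_measure hb' (by simp)).1 (integrable_add_measure.1 hi).2
    have heq : ∫ ω, X ω ∂Q = a * ∫ ω, X ω ∂Q₁ + b * ∫ ω, X ω ∂Q₂ := by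
      rw [hQ, integral_convex_comb hi₁ hi₂ ha.le hb.le]
    rw [expect_eq_integral hi₁] at hle₁
    rw [expect_eq_integral hi₂] at hle₂
    rw [expect_eq_integral hi, heq]
    obtain rfl : b = 1 - a := by linarith
    rcases le_total (∫ ω, X ω ∂Q₁) (∫ ω, X ω ∂Q₂) with h | h
    · refine hle₁.trans (EReal.coe_le_coe ?_)
      nlinarith
    · refine hle₂.trans (EReal.coe_le_coe ?_)
      nlinarith

/-! ### Integrability and weak continuity on the strong `L¹`-space -/

lemma integrable_of_mem_strongL1 {D : Set (Measure Ω)} (hD : D ⊆ absContProb P)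
    {X : Ω →ₘ[P] ℝ} (hX : X ∈ strongL1 P D) {Q : Measure Ω} (hQ : Q ∈ D) : Integrable X Q := by
  have := (hD hQ).1
  obtain ⟨n, hn⟩ := (hX.eventually (gt_mem_nhds (zero_lt_one' ℝ≥0∞))).exists
  have hlt := (le_iSup₂ (f := fun Q (_ : Q ∈ D) =>
    ∫⁻ ω in {ω | (n : ℝ) < |X ω|}, ENNReal.ofReal |X ω| ∂Q) Q hQ).trans_lt hn
  have hm : MeasurableSet {ω | (n : ℝ) < |X ω|} :=
    measurableSet_lt measurable_const X.measurable.abs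
  refine ⟨X.stronglyMeasurable.aestronglyMeasurable, ?_⟩
  rw [hasFiniteIntegral_iff_norm, ← lintegral_add_compl _ hm]
  refine ENNReal.add_lt_top.2 ⟨hlt.trans ENNReal.one_lt_top, ?_⟩
  refine lt_of_le_of_lt (setLIntegral_mono measurable_const (g := fun _ => ENNReal.ofReal n)
    fun ω hω => ENNReal.ofReal_le_ofReal ?_) ?_
  · simpa using hω
  · simp [ENNReal.mul_lt_top, measure_lt_top]

/-- Expectations of elements of the strong `L¹`-space are weakly continuous. -/
lemma continuousOn_integral {D : Set (Measure Ω)} (hD : D ⊆ absContProb P)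
    {X : Ω →ₘ[P] ℝ} (hX : X ∈ strongL1 P D) :
    @ContinuousOn _ _ (weakTopology Ω) _ (fun Q : Measure Ω => ∫ ω, X ω ∂Q) D := by
  let _ := weakTopology Ω
  let T : ℕ → Ω → ℝ := fun n => {ω | |X ω| ≤ n}.indicator X
  have hm (n : ℕ) : MeasurableSet {ω | |X ω| ≤ n} :=
    measurableSet_le X.measurable.abs measurable_const
  have hT (n : ℕ) : Continuous fun Q : Measure Ω => ∫ ω, T n ω ∂Q := by
    have hb : Measurable (T n) ∧ ∃ C : ℝ, ∀ ω, |T n ω| ≤ C := by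
      refine ⟨X.measurable.indicator (hm n), n, fun ω => ?_⟩
      by_cases h : |X ω| ≤ n
      · simp [T, h]
      · simp [T, h]
    exact continuous_pi_iff.1 (continuous_induced_dom (f := fun (Q : Measure Ω)
      (Z : {Z : Ω → ℝ // Measurable Z ∧ ∃ C : ℝ, ∀ ω, |Z ω| ≤ C}) => ∫ ω, Z.1 ω ∂Q)) ⟨T n, hb⟩
  -- The error of truncating at `n` is bounded on all of `D` by the tail supremum, so the
  -- convergence is uniform.
  refine TendstoUniformlyOn.continuousOn (F := fun n Q => ∫ ω, T n ω ∂Q) (p := atTop) ?_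
    (Frequently.of_forall fun n => (hT n).continuousOn)
  rw [Metric.tendstoUniformlyOn_iff]
  intro ε hε
  filter_upwards [hX.eventually (gt_mem_nhds (ENNReal.ofReal_pos.2 hε))] with n hn Q hQ
  have := (hD hQ).1
  have hlt := (le_iSup₂ (f := fun Q (_ : Q ∈ D) =>
    ∫⁻ ω in {ω | (n : ℝ) < |X ω|}, ENNReal.ofReal |X ω| ∂Q) Q hQ).trans_lt hn
  have hi := integrable_of_mem_strongL1 hD hX hQ
  have hc : {ω | |X ω| ≤ n}ᶜ = {ω | (n : ℝ) < |X ω|} := by ext; simp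
  rw [integral_indicator (hm n), ← integral_add_compl (hm n) hi, dist_eq_norm,
    add_sub_cancel_left, hc]
  refine lt_of_le_of_lt (norm_integral_le_lintegral_norm _) ?_
  exact (ENNReal.lt_ofReal_iff_toReal_lt (ne_top_of_lt hlt)).1 hlt


/-! ### Expectations of trades -/

lemma integrable_add_and_integral_eq {Q : Measure Ω} (hQ : Q ≪ P) {X Y : Ω →ₘ[P] ℝ}
    (hX : Integrable X Q) (hY : Integrable Y Q) :
    Integrable (X + Y : Ω →ₘ[P] ℝ) Q ∧
      ∫ ω, (X + Y : Ω →ₘ[P] ℝ) ω ∂Q = ∫ ω, X ω ∂Q + ∫ ω, Y ω ∂Q := by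
  have h : (X + Y : Ω →ₘ[P] ℝ) =ᵐ[Q] fun ω => X ω + Y ω := hQ.ae_eq (AEEqFun.coeFn_add X Y)
  exact ⟨(hX.add hY).congr h.symm, by rw [integral_congr_ae h, integral_add hX hY]⟩

lemma integrable_smul_and_integral_eq {Q : Measure Ω} (hQ : Q ≪ P) {X : Ω →ₘ[P] ℝ}
    (hX : Integrable X Q) (c : ℝ) :
    Integrable (c • X : Ω →ₘ[P] ℝ) Q ∧
      ∫ ω, (c • X : Ω →ₘ[P] ℝ) ω ∂Q = c * ∫ ω, X ω ∂Q := by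
  have h : (c • X : Ω →ₘ[P] ℝ) =ᵐ[Q] fun ω => c * X ω := hQ.ae_eq (AEEqFun.coeFn_smul c X)
  exact ⟨(hX.const_mul c).congr h.symm, by rw [integral_congr_ae h, integral_const_mul]⟩

lemma integrable_sum_and_integral_eq {ι : Type*} {Q : Measure Ω} (hQ : Q ≪ P) (s : Finset ι)
    {X : ι → Ω →ₘ[P] ℝ} (hX : ∀ i, Integrable (X i) Q) (c : ι → ℝ) :
    Integrable (∑ i ∈ s, c i • X i : Ω →ₘ[P] ℝ) Q ∧
      ∫ ω, (∑ i ∈ s, c i • X i : Ω →ₘ[P] ℝ) ω ∂Q = ∑ i ∈ s, c i * ∫ ω, X i ω ∂Q := by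
  classical
  induction s using Finset.induction_on with
  | empty =>
    have h : ((0 : Ω →ₘ[P] ℝ) : Ω → ℝ) =ᵐ[Q] fun _ => (0 : ℝ) := hQ.ae_eq AEEqFun.coeFn_zero
    simp only [Finset.sum_empty]
    exact ⟨(integrable_zero _ _ _).congr h.symm, by rw [integral_congr_ae h]; simp⟩
  | insert i s hi ih =>
    obtain ⟨h₁, h₂⟩ := integrable_smul_and_integral_eq hQ (hX i) (c i)
    obtain ⟨h₃, h₄⟩ := integrable_add_and_integral_eq hQ h₁ ih.1
    rw [Finset.sum_insert hi, Finset.sum_insert hi, ← h₂, ← ih.2]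
    exact ⟨h₃, h₄⟩

lemma coeFn_sub_const {Q : Measure Ω} (hQ : Q ≪ P) (F : Ω →ₘ[P] ℝ) (x : ℝ) :
    (F - AEEqFun.const Ω x : Ω →ₘ[P] ℝ) =ᵐ[Q] fun ω => F ω - x := by
  have h₁ := hQ.ae_eq (AEEqFun.coeFn_sub F (AEEqFun.const Ω x))
  have h₂ := hQ.ae_eq (AEEqFun.coeFn_const (μ := P) Ω x)
  filter_upwards [h₁, h₂] with ω h₁ h₂
  simp [h₁, h₂]

lemma coeFn_hedged {Q : Measure Ω} (hQ : Q ≪ P) (W X F : Ω →ₘ[P] ℝ) (h x : ℝ) :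
    (W + X + h • (F - AEEqFun.const Ω x) : Ω →ₘ[P] ℝ) =ᵐ[Q]
      fun ω => X ω + (W ω + h * (F ω - x)) := by
  filter_upwards [hQ.ae_eq (AEEqFun.coeFn_add (W + X) (h • (F - AEEqFun.const Ω x))),
    hQ.ae_eq (AEEqFun.coeFn_add W X), hQ.ae_eq (AEEqFun.coeFn_smul h (F - AEEqFun.const Ω x)),
    coeFn_sub_const hQ F x] with ω h₁ h₂ h₃ h₄
  simp only [h₁, Pi.add_apply, h₂, h₃, Pi.smul_apply, h₄, smul_eq_mul]
  ring

lemma integral_hedged {Q : Measure Ω} [IsProbabilityMeasure Q] {W F : Ω → ℝ}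
    (hW : Integrable W Q) (hF : Integrable F Q) (h x : ℝ) :
    Integrable (fun ω => W ω + h * (F ω - x)) Q ∧
      ∫ ω, W ω + h * (F ω - x) ∂Q = ∫ ω, W ω ∂Q + h * (∫ ω, F ω ∂Q - x) := by
  have hi : Integrable (fun ω => F ω - x) Q := hF.sub (integrable_const x)
  refine ⟨hW.add (hi.const_mul h), ?_⟩
  rw [integral_add hW (hi.const_mul h), integral_const_mul, integral_sub hF (integrable_const x)]
  simp

/-- A risk-neutral measure pricing `F` at `x` does not see the hedged positions as improvements. -/
lemma expect_hedged_le {A : Set (Ω →ₘ[P] ℝ)} {Q : Measure Ω} (hQ : Q ∈ riskNeutral A)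
    {W F : Ω →ₘ[P] ℝ} (hW : Integrable W Q) (hF : Integrable F Q) {x : ℝ}
    (hx : expect Q F = x) {X : Ω →ₘ[P] ℝ} (hX : X ∈ A) (h : ℝ) :
    expect Q (W + X + h • (F - AEEqFun.const Ω x)) ≤ expect Q W := by
  have := hQ.1.1
  obtain ⟨hi, he⟩ := integral_hedged hW hF h x
  refine (expect_add_le (hQ.2 X hX) hi (coeFn_hedged hQ.1.2 W X F h x)).trans ?_
  rw [expect_eq_integral hF, EReal.coe_eq_coe_iff] at hx
  rw [he, hx, expect_eq_integral hW]
  simp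

/-! ### Separation in finite dimension -/

lemma sum_smul_mem_of_zero_mem {E ι : Type*} [AddCommGroup E] [Module ℝ E] [Fintype ι]
    {A : Set E} (hA : Convex ℝ A) (h0 : (0 : E) ∈ A) {X : ι → E} (hX : ∀ i, X i ∈ A)
    {c : ι → ℝ} (hc : ∀ i, 0 ≤ c i) (hsum : ∑ i, c i ≤ 1) : ∑ i, c i • X i ∈ A := by
  -- The missing weight `1 - ∑ c i` is placed on `0 ∈ A`.
  have h := hA.sum_mem (t := Finset.univ) (w := fun o : Option ι => o.elim (1 - ∑ i, c i) c)
    (z := fun o => o.elim 0 X) ?_ ?_ ?_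
  · simpa [Fintype.sum_option] using h
  · rintro (_ | i) _
    · simpa using hsum
    · exact hc i
  · simp [Fintype.sum_option]
  · rintro (_ | i) _
    · exact h0
    · exact hX i

/-- A compact convex set in `ℝ × ℝ × ℝⁿ` that misses `(-∞, w] × {x} × (-∞, 0]ⁿ` is strictly
separated from it by a linear functional with the appropriate signs. -/
lemma exists_separating_weights {ι : Type*} [Fintype ι] {K : Set (ℝ × ℝ × (ι → ℝ))}
    (hK : IsCompact K) (hKc : Convex ℝ K) (w x : ℝ)
    (hd : ∀ p ∈ K, ¬ (p.1 ≤ w ∧ p.2.1 = x ∧ ∀ i, p.2.2 i ≤ 0)) :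
    ∃ (a c δ : ℝ) (b : ι → ℝ), 0 ≤ a ∧ (∀ i, 0 ≤ b i) ∧ 0 < δ ∧
      ∀ p ∈ K, a * w + c * x + δ ≤ a * p.1 + c * p.2.1 + ∑ i, b i * p.2.2 i := by
  classical
  let C : Set (ℝ × ℝ × (ι → ℝ)) := Set.Iic w ×ˢ ({x} ×ˢ Set.Iic 0)
  have hC : Convex ℝ C := (convex_Iic w).prod ((convex_singleton x).prod (convex_Iic 0))
  have hCc : IsClosed C := isClosed_Iic.prod (isClosed_singleton.prod isClosed_Iic)
  have hdisj : Disjoint K C := by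
    rw [Set.disjoint_left]
    exact fun p hp hpC => hd p hp ⟨hpC.1, hpC.2.1, hpC.2.2⟩
  obtain ⟨f, s, t, hfs, hst, hft⟩ := geometric_hahn_banach_compact_closed hKc hK hC hCc hdisj
  have hrep (p : ℝ × ℝ × (ι → ℝ)) : f p = p.1 * f (1, 0, 0) + p.2.1 * f (0, 1, 0) +
      ∑ i, p.2.2 i * f (0, 0, Pi.single i 1) := by
    have hp : p = p.1 • ((1, 0, 0) : ℝ × ℝ × (ι → ℝ)) + p.2.1 • (0, 1, 0) +
        ∑ i, p.2.2 i • ((0, 0, Pi.single i 1) : ℝ × ℝ × (ι → ℝ)) := by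
      refine Prod.ext ?_ (Prod.ext ?_ (funext fun j => ?_))
      · simp [Prod.fst_sum]
      · simp [Prod.fst_sum, Prod.snd_sum]
      · simp [Prod.snd_sum, Finset.sum_apply, Pi.single_apply]
    conv_lhs => rw [hp]
    simp only [map_add, map_sum, map_smul, smul_eq_mul]
  -- A functional bounded below along a ray of `C` cannot decrease along it; this fixes the signs of
  -- the weights.
  have hneg {d r : ℝ} (h : ∀ k : ℝ, 0 ≤ k → t < r - k * d) : d ≤ 0 := by
    by_contra! hd
    have h1 := h (max 0 ((r - t) / d)) (le_max_left _ _)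
    have h2 : (r - t) / d * d ≤ max 0 ((r - t) / d) * d :=
      mul_le_mul_of_nonneg_right (le_max_right _ _) hd.le
    rw [div_mul_cancel₀ _ hd.ne'] at h2
    linarith
  have ha : f (1, 0, 0) ≤ 0 := by
    refine hneg (r := w * f (1, 0, 0) + x * f (0, 1, 0)) fun k hk => ?_
    have := hft (w - k, x, 0) ⟨by simpa using hk, rfl, le_refl (0 : ι → ℝ)⟩
    rw [hrep] at this
    simp only [Pi.zero_apply, zero_mul, Finset.sum_const_zero] at this
    linarith
  have hb (i : ι) : f (0, 0, Pi.single i 1) ≤ 0 := by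
    refine hneg (r := w * f (1, 0, 0) + x * f (0, 1, 0)) fun k hk => ?_
    have := hft (w, x, Pi.single i (-k)) ⟨le_refl w, rfl, fun j => ?_⟩
    · rw [hrep] at this
      simp only [Pi.single_apply, ite_mul, zero_mul, Finset.sum_ite_eq', Finset.mem_univ,
        if_true] at this
      linarith
    · rcases eq_or_ne j i with rfl | hj
      · simpa using hk
      · simp [hj]
  refine ⟨-f (1, 0, 0), -f (0, 1, 0), t - s, fun i => -f (0, 0, Pi.single i 1), by linarith,
    fun i => by linarith [hb i], by linarith, fun p hp => ?_⟩
  have h1 := hfs p hp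
  have h2 := hft (w, x, 0) ⟨le_refl w, rfl, le_refl (0 : ι → ℝ)⟩
  rw [hrep] at h1 h2
  simp only [Pi.zero_apply, zero_mul, Finset.sum_const_zero] at h2
  simp only [neg_mul, Finset.sum_neg_distrib, mul_comm (f _)]
  linarith

/-- The finite-dimensional step: finitely many strongly integrable attainable claims admit a
common extreme measure which prices `F` at `x`. -/
lemma exists_measure_of_finite {u : (Ω →ₘ[P] ℝ) → EReal} {D : Set (Measure Ω)}
    (hD : IsDeterminingSet P u D) (hDc : IsWeaklyCompact D) {A : Set (Ω →ₘ[P] ℝ)}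
    (hA : Convex ℝ A) (hA0 : (0 : Ω →ₘ[P] ℝ) ∈ A) {W F : Ω →ₘ[P] ℝ} (hW : W ∈ strongL1 P D)
    (hF : F ∈ strongL1 P D) {x w : ℝ} (hw : ∀ Q ∈ D, w ≤ ∫ ω, W ω ∂Q)
    (hmax : ∀ X ∈ A, ∀ h : ℝ, u (W + X + h • (F - AEEqFun.const Ω x)) ≤ w)
    {ι : Type*} [Fintype ι] {X : ι → Ω →ₘ[P] ℝ} (hX : ∀ i, X i ∈ strongL1 P D ∩ A) :
    ∃ Q ∈ D, ∫ ω, W ω ∂Q ≤ w ∧ ∫ ω, F ω ∂Q = x ∧ ∀ i, ∫ ω, X i ω ∂Q ≤ 0 := by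
  let _ := weakTopology Ω
  have hac := hD.1.2.1
  have hi {Y : Ω →ₘ[P] ℝ} (hY : Y ∈ strongL1 P D) {Q : Measure Ω} (hQ : Q ∈ D) :
    Integrable Y Q := integrable_of_mem_strongL1 hac hY hQ
  by_contra! hcon
  let Φ : Measure Ω → ℝ × ℝ × (ι → ℝ) :=
    fun Q => (∫ ω, W ω ∂Q, ∫ ω, F ω ∂Q, fun i => ∫ ω, X i ω ∂Q)
  have hΦ : ContinuousOn Φ D := (continuousOn_integral hac hW).prodMk
    ((continuousOn_integral hac hF).prodMk
      (continuousOn_pi.2 fun i => continuousOn_integral hac (hX i).1))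
  have hK : IsCompact (Φ '' D) := IsCompact.image_of_continuousOn hDc hΦ
  have hKc : Convex ℝ (Φ '' D) := by
    rintro _ ⟨Q₁, h₁, rfl⟩ _ ⟨Q₂, h₂, rfl⟩ a b ha hb hab
    refine ⟨_, hD.convex h₁ h₂ ha hb hab, ?_⟩
    refine Prod.ext ?_ (Prod.ext ?_ (funext fun i => ?_))
    · exact integral_convex_comb (hi hW h₁) (hi hW h₂) ha hb
    · exact integral_convex_comb (hi hF h₁) (hi hF h₂) ha hb
    · exact integral_convex_comb (hi (hX i).1 h₁) (hi (hX i).1 h₂) ha hb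
  obtain ⟨a, c, δ, b, ha, hb, hδ, hsep⟩ := exists_separating_weights hK hKc w x (by
    rintro _ ⟨Q, hQ, rfl⟩ ⟨h₁, h₂, h₃⟩
    obtain ⟨i, hi⟩ := hcon Q hQ h₁ h₂
    exact hi.not_ge (h₃ i))
  have hS : 0 ≤ ∑ i, b i := Finset.sum_nonneg fun i _ => hb i
  -- One scaling serves two ends: `ε * ∑ b i ≤ 1` keeps the combination in `A`, and `ε * a ≤ 1`
  -- leaves a nonnegative share of `W` below.
  obtain ⟨ε, hε, hεS⟩ : ∃ ε : ℝ, 0 < ε ∧ ε * (1 + a + ∑ i, b i) = 1 :=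
    ⟨(1 + a + ∑ i, b i)⁻¹, by positivity, inv_mul_cancel₀ (by positivity)⟩
  have hεa : ε * a ≤ 1 := by nlinarith [mul_nonneg hε.le hS]
  have hmem : ∑ i, (ε * b i) • X i ∈ A := by
    refine sum_smul_mem_of_zero_mem hA hA0 (fun i => (hX i).2)
      (fun i => mul_nonneg hε.le (hb i)) ?_
    rw [← Finset.mul_sum]
    nlinarith [mul_nonneg hε.le ha]
  have hle := hmax _ hmem (ε * c)
  have hge : ((w + ε * δ : ℝ) : EReal) ≤
      u (W + ∑ i, (ε * b i) • X i + (ε * c) • (F - AEEqFun.const Ω x)) := by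
    rw [hD.1.2.2]
    refine le_iInf₂ fun Q hQ => ?_
    have := (hac hQ).1
    obtain ⟨hI, hE⟩ := integrable_sum_and_integral_eq (hac hQ).2 Finset.univ
      (fun i => hi (hX i).1 hQ) (fun i => ε * b i)
    obtain ⟨hI', hE'⟩ := integral_hedged (hi hW hQ) (hi hF hQ) (ε * c) x
    have hZ := coeFn_hedged (hac hQ).2 W (∑ i, (ε * b i) • X i) F (ε * c) x
    rw [expect_eq_integral ((hI.add hI').congr hZ.symm), integral_congr_ae hZ,
      integral_add hI hI', hE, hE']
    refine EReal.coe_le_coe ?_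
    have h₁ := mul_le_mul_of_nonneg_left (hsep _ ⟨Q, hQ, rfl⟩) hε.le
    -- The trade holds `W` with coefficient `1`, not `ε * a`; the remainder `1 - ε * a` is bounded
    -- using `w ≤ E_Q W`.
    have h₂ := mul_le_mul_of_nonneg_left (hw Q hQ) (sub_nonneg.2 hεa)
    simp only [Φ] at h₁
    simp only [mul_assoc, ← Finset.mul_sum]
    linarith
  have := EReal.coe_le_coe_iff.1 (hge.trans hle)
  nlinarith

/-- A weakly continuous function attains its minimum on the compact `D`, so `u(W)` is finite. -/
lemma exists_integral_eq_utility {u : (Ω →ₘ[P] ℝ) → EReal} {D : Set (Measure Ω)}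
    (hD : Represents P u D) (hDc : IsWeaklyCompact D) {W : Ω →ₘ[P] ℝ} (hW : W ∈ strongL1 P D) :
    ∃ w : ℝ, u W = w ∧ ∀ Q ∈ D, w ≤ ∫ ω, W ω ∂Q := by
  let _ := weakTopology Ω
  obtain ⟨hne, hac, hu⟩ := hD
  obtain ⟨Q₀, hQ₀, hmin⟩ :=
    IsCompact.exists_isMinOn hDc hne (continuousOn_integral hac hW)
  refine ⟨∫ ω, W ω ∂Q₀, le_antisymm ?_ ?_, fun Q hQ => hmin hQ⟩
  · rw [hu, ← expect_eq_integral (integrable_of_mem_strongL1 hac hW hQ₀)]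
    exact iInf₂_le _ hQ₀
  · rw [hu]
    refine le_iInf₂ fun Q hQ => ?_
    rw [expect_eq_integral (integrable_of_mem_strongL1 hac hW hQ)]
    exact EReal.coe_le_coe (hmin hQ)

lemma exists_extremeMeasure_of_forall_le {u : (Ω →ₘ[P] ℝ) → EReal} {D : Set (Measure Ω)}
    (hD : IsDeterminingSet P u D) (hDc : IsWeaklyCompact D) {A : Set (Ω →ₘ[P] ℝ)}
    (hA : Convex ℝ A) (hA0 : (0 : Ω →ₘ[P] ℝ) ∈ A) (hAD : IsConsistent D A)
    {W F : Ω →ₘ[P] ℝ} (hW : W ∈ strongL1 P D) (hF : F ∈ strongL1 P D) {x : ℝ}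
    (hmax : ∀ X ∈ A, ∀ h : ℝ, u (W + X + h • (F - AEEqFun.const Ω x)) ≤ u W) :
    ∃ Q ∈ extremeMeasures D W ∩ riskNeutral A, expect Q F = x := by
  classical
  let _ := weakTopology Ω
  have hac := hD.1.2.1
  obtain ⟨w, huw, hw⟩ := exists_integral_eq_utility hD.1 hDc hW
  obtain ⟨A', hA', hAA'⟩ := hAD
  rw [huw] at hmax
  have : CompactSpace D := isCompact_iff_compactSpace.1 hDc
  have hcont {Y : Ω →ₘ[P] ℝ} (hY : Y ∈ strongL1 P D) :
      Continuous fun Q : D => ∫ ω, Y ω ∂(Q : Measure Ω) :=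
    continuousOn_iff_continuous_domRestrict.1 (continuousOn_integral hac hY)
  let S : Set D := {Q | ∫ ω, W ω ∂(Q : Measure Ω) ≤ w ∧ ∫ ω, F ω ∂(Q : Measure Ω) = x}
  have hS : IsClosed S :=
    (isClosed_le (hcont hW) continuous_const).inter (isClosed_eq (hcont hF) continuous_const)
  -- Finite intersection property, over `A'` only: general elements of `A` need not give closed
  -- conditions. Consistency then passes to all of `A`.
  obtain ⟨Q, ⟨hQW, hQF⟩, hQA⟩ := hS.isCompact.inter_iInter_nonempty
    (fun X : A' => {Q : D | ∫ ω, (X : Ω →ₘ[P] ℝ) ω ∂(Q : Measure Ω) ≤ 0})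
    (fun X => isClosed_le (hcont (hA' X.2).1) continuous_const) (fun s => by
      obtain ⟨Q, hQ, h₁, h₂, h₃⟩ := exists_measure_of_finite hD hDc hA hA0 hW hF hw hmax
        (X := fun i : s => ((i : A') : Ω →ₘ[P] ℝ)) (fun i => hA' i.1.2)
      exact ⟨⟨Q, hQ⟩, ⟨h₁, h₂⟩, Set.mem_iInter₂.2 fun i hi => h₃ ⟨i, hi⟩⟩)
  have hQR : (Q : Measure Ω) ∈ D ∩ riskNeutral A := by
    rw [hAA']
    refine ⟨Q.2, hac Q.2, fun X hX => ?_⟩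
    rw [expect_eq_integral (integrable_of_mem_strongL1 hac (hA' hX).1 Q.2)]
    exact_mod_cast Set.mem_iInter.1 hQA ⟨X, hX⟩
  have hEW := expect_eq_integral (integrable_of_mem_strongL1 hac hW Q.2)
  refine ⟨Q, ⟨⟨Q.2, ?_, ?_, ?_⟩, hQR.2⟩, ?_⟩
  · rw [← hD.1.2.2, huw, hEW, le_antisymm hQW (hw Q Q.2)]
  · rw [hEW]; exact EReal.coe_ne_bot _
  · rw [hEW]; exact EReal.coe_ne_top _
  · rw [expect_eq_integral (integrable_of_mem_strongL1 hac hF Q.2), hQF]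

/-! ### NBC prices and the two parts of the theorem -/

lemma mem_nbcPrices_iff {u : (Ω →ₘ[P] ℝ) → EReal} {A : Set (Ω →ₘ[P] ℝ)}
    (hA0 : (0 : Ω →ₘ[P] ℝ) ∈ A) {W F : Ω →ₘ[P] ℝ} {x : ℝ} :
    x ∈ nbcPrices u A W F ↔
      ∀ X ∈ A, ∀ h : ℝ, u (W + X + h • (F - AEEqFun.const Ω x)) ≤ u W := by
  refine ⟨fun hx X hX h => hx.2 ⟨X, hX, h, rfl⟩, fun hx => ⟨⟨0, hA0, 0, by simp⟩, ?_⟩⟩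
  rintro _ ⟨X, hX, h, rfl⟩
  exact hx X hX h

lemma zero_mem_strongL1 {D : Set (Measure Ω)} (hD : D ⊆ absContProb P) :
    (0 : Ω →ₘ[P] ℝ) ∈ strongL1 P D := by
  have (n : ℕ) : ⨆ Q ∈ D, ∫⁻ ω in {ω | (n : ℝ) < |(0 : Ω →ₘ[P] ℝ) ω|},
      ENNReal.ofReal |(0 : Ω →ₘ[P] ℝ) ω| ∂Q = 0 := by
    simp only [ENNReal.iSup_eq_zero]
    intro Q hQ
    have h : ((0 : Ω →ₘ[P] ℝ) : Ω → ℝ) =ᵐ[Q] fun _ => (0 : ℝ) :=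
      (hD hQ).2.ae_eq AEEqFun.coeFn_zero
    refine (lintegral_congr_ae (ae_restrict_of_ae (h.mono fun ω hω => ?_))).trans
      lintegral_zero
    simp [hω]
  simp only [strongL1, Set.mem_ofPred_eq, this]
  exact tendsto_const_nhds

end CoherentRisk

open CoherentRisk in
theorem mainTheorem10 {Ω : Type*} [MeasurableSpace Ω] (P : Measure Ω) [IsProbabilityMeasure P]
    (u : (Ω →ₘ[P] ℝ) → EReal) (D : Set (Measure Ω))
    (hD : CoherentRisk.IsDeterminingSet P u D) (hDc : CoherentRisk.IsWeaklyCompact D)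
    (A : Set (Ω →ₘ[P] ℝ)) (hA : Convex ℝ A) (hA0 : (0 : Ω →ₘ[P] ℝ) ∈ A)
    (hAD : CoherentRisk.IsConsistent D A)
    (W : Ω →ₘ[P] ℝ) (hW : W ∈ CoherentRisk.strongL1 P D)
    (F : Ω →ₘ[P] ℝ) (hF : F ∈ CoherentRisk.strongL1 P D) :
    ((fun x : ℝ => (x : EReal)) '' CoherentRisk.nbcPrices u A W F =
      (fun Q : Measure Ω => CoherentRisk.expect Q F) ''
        (CoherentRisk.extremeMeasures D W ∩ CoherentRisk.riskNeutral A)) ∧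
    (CoherentRisk.IsOptimalEndowment u A W →
      CoherentRisk.nbcPrices u A W F =
        CoherentRisk.argmin
          (CoherentRisk.lowerBoundary (CoherentRisk.generator D A F W))) := by
  have hac := hD.1.2.1
  have hu := hD.1.2.2
  have hiW {Q : Measure Ω} (hQ : Q ∈ D) := integrable_of_mem_strongL1 hac hW hQ
  have hiF {Q : Measure Ω} (hQ : Q ∈ D) := integrable_of_mem_strongL1 hac hF hQ
  constructor
  · ext r
    constructor
    · rintro ⟨x, hx, rfl⟩
      exact exists_extremeMeasure_of_forall_le hD hDc hA hA0 hAD hW hF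
        ((mem_nbcPrices_iff hA0).1 hx)
    · rintro ⟨Q, ⟨⟨hQD, hQW, -⟩, hQR⟩, rfl⟩
      refine ⟨∫ ω, F ω ∂Q, (mem_nbcPrices_iff hA0).2 fun X hX h => ?_,
        (expect_eq_integral (hiF hQD)).symm⟩
      rw [hu W, ← hQW, hu]
      exact (iInf₂_le Q hQD).trans
        (expect_hedged_le hQR (hiW hQD) (hiF hQD) (expect_eq_integral (hiF hQD)) hX h)
  · intro hopt
    have hle (y : ℝ) : u W ≤ lowerBoundary (generator D A F W) y := by
      refine le_iInf ?_
      rintro ⟨z, Q, hQ, -, hz⟩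
      rw [← hz, hu]
      exact iInf₂_le Q hQ.1
    have hge {Q : Measure Ω} (hQ : Q ∈ extremeMeasures D W ∩ riskNeutral A) {x : ℝ}
        (hx : expect Q F = x) : lowerBoundary (generator D A F W) x ≤ u W := by
      have hEW := expect_eq_integral (hiW hQ.1.1)
      refine (iInf_le _ (⟨∫ ω, W ω ∂Q, Q, ⟨hQ.1.1, hQ.2⟩, hx, hEW⟩ :
        {y : ℝ // (x, y) ∈ generator D A F W})).trans ?_
      rw [← hEW, hu, hQ.1.2.1]
    ext x
    constructor
    · intro hx y
      obtain ⟨Q, hQ, hQF⟩ := exists_extremeMeasure_of_forall_le hD hDc hA hA0 hAD hW hF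
        ((mem_nbcPrices_iff hA0).1 hx)
      exact (hge hQ hQF).trans (hle y)
    · intro hx
      -- With the claim `0` priced at `0` the hedge vanishes, so optimality alone yields a
      -- risk-neutral extreme measure.
      obtain ⟨Q, hQ, -⟩ := exists_extremeMeasure_of_forall_le hD hDc hA hA0 hAD hW
        (zero_mem_strongL1 hac) (x := 0) (fun X hX h => by
          have h0 : (AEEqFun.const Ω (0 : ℝ) : Ω →ₘ[P] ℝ) = 0 := rfl
          rw [h0, sub_zero, smul_zero, add_zero]
          exact hopt.2 ⟨X, hX, rfl⟩)
      refine (mem_nbcPrices_iff hA0).2 fun X hX h => ?_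
      -- The value `f x` is squeezed in between: each risk-neutral measure pricing `F` at `x` bounds
      -- the trade, hence so does their infimum, and `f x ≤ f (E_Q F) ≤ u W`.
      refine le_trans ?_ ((hx _).trans (hge hQ (expect_eq_integral (hiF hQ.1.1))))
      refine le_iInf ?_
      rintro ⟨z, Q', hQ', hx', hz⟩
      rw [← hz, hu]
      exact (iInf₂_le Q' hQ'.1).trans
        (expect_hedged_le hQ'.2 (hiW hQ'.1) (hiF hQ'.1) hx' hX h)
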